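/- Let $H$ be a separable complex Hilbert space and let $\mathcal L$ be a commutative subspace lattice on $H$: a family of closed subspaces of $H$ that contains $0$ and $H$, is closed under arbitrary intersections and closed linear spans, and whose orthogonal projections commute with one another. Subspaces are identified with their orthogonal projections. Let $\operatorname{Alg}\mathcal L$ be the algebra of all bounded operators on $H$ that leave every element of $\mathcal L$ invariant. An \emph{atom} of $\mathcal L$ is a projection $A=P-Q$ with $P,Q\in\mathcal L$, $Q<P$, such that for every $F\in\mathcal L$ either $AF=0$ or $AF=A$. An element of $\mathcal L$ is \emph{generated} by a set of atoms if it is the smallest element of $\mathcal L$ that contains each of them. A \emph{linear manifold} is a linear subspace of $H$, not necessarily closed; it is \emph{invariant} if every $T\in\operatorname{Alg}\mathcal L$ maps it into itself. An \emph{invariant operator range} is an invariant linear manifold that is the range of a bounded linear operator on $H$. The following conditions are equivalent: \begin{enumerate} \item[(1)] $\mathcal L$ is hyperatomic: every non-zero element of $\mathcal L$ is generated by finitely many atoms. \item[(2)] Every ascending sequence $F_1\le F_2\le\cdots$ in $\mathcal L$ is eventually constant. \item[(3)] Every invariant operator range of $\operatorname{Alg}\mathcal L$ is closed. \item[(4)]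 Every invariant linear manifold of $\operatorname{Alg}\mathcal L$ is closed. \end{enumerate} Moreover, if (3) holds, then every invariant operator range is an element of $\mathcal L$, and if (4) holds, then every invariant linear manifold is an element of $\mathcal L$. If $\mathcal L$ is a nest (that is, totally ordered by inclusion), then each of the following conditions is also equivalent to (1)--(4): \begin{enumerate} \item[(5)] Every non-zero $P\in\mathcal L$ has an immediate predecessor: there is $Q\in\mathcal L$ with $Q<P$ such that no $F\in\mathcal L$ satisfies $Q<F<P$. \item[(6)] The invariant operator ranges of $\operatorname{Alg}\mathcal L$ are totally ordered by inclusion. \item[(7)] The invariant linear manifolds of $\operatorname{Alg}\mathcal L$ are totally ordered by inclusion. \end{enumerate} -/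

import Mathlib

namespace SubspaceLattice

variable {H : Type*} [NormedAddCommGroup H] [InnerProductSpace ℂ H] [CompleteSpace H]

/-- The orthogonal projection of `H` onto the closed subspace `E`, as a bounded operator on `H`. -/
noncomputable def proj (E : ClosedSubmodule ℂ H) : H →L[ℂ] H :=
  E.toSubmodule.starProjection

/-- A complete lattice of closed subspaces (it is closed under arbitrary intersections and closed
linear spans, so it contains `0` and `H`) is a commutative subspace lattice if the orthogonal
projections onto its elements commute with one another. -/
def IsCSL (L : CompleteSublattice (ClosedSubmodule ℂ H)) : Prop :=
  ∀ E ∈ L, ∀ F ∈ L, Commute (proj E) (proj F)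

/-- A nest is a subspace lattice that is totally ordered by inclusion. -/
def IsNest (L : CompleteSublattice (ClosedSubmodule ℂ H)) : Prop :=
  ∀ E ∈ L, ∀ F ∈ L, E ≤ F ∨ F ≤ E

/-- `Alg L`: the algebra of the bounded operators that leave every element of `L` invariant. -/
def Alg (L : CompleteSublattice (ClosedSubmodule ℂ H)) : Subalgebra ℂ (H →L[ℂ] H) where
  carrier := {T | ∀ E ∈ L, ∀ x ∈ E, T x ∈ E}
  mul_mem' hS hT E hE x hx := hS E hE _ (hT E hE x hx)
  add_mem' hS hT E hE x hx := add_mem (hS E hE x hx) (hT E hE x hx)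
  algebraMap_mem' c E _ x hx := by
    simpa [Algebra.algebraMap_eq_smul_one] using SMulMemClass.smul_mem c hx

/-- An atom associated with `L` is a minimal non-zero interval from `L`: a projection `A = P - Q`
with `Q < P` in `L` such that `A F` is `0` or `A` for every `F` in `L`. -/
def IsLatticeAtom (L : CompleteSublattice (ClosedSubmodule ℂ H)) (A : H →L[ℂ] H) : Prop :=
  (∃ P ∈ L, ∃ Q ∈ L, Q < P ∧ A = proj P - proj Q) ∧
    ∀ F ∈ L, A * proj F = 0 ∨ A * proj F = A

/-- The smallest element of `L` that contains the ranges of all the operators in `S`. -/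
noncomputable def generatedBy (L : CompleteSublattice (ClosedSubmodule ℂ H))
    (S : Set (H →L[ℂ] H)) : ClosedSubmodule ℂ H :=
  sInf {F | F ∈ L ∧ ∀ A ∈ S, ∀ x, A x ∈ F}

/-- `L` is hyperatomic if each of its non-zero elements is generated by finitely many atoms. -/
def IsHyperatomic (L : CompleteSublattice (ClosedSubmodule ℂ H)) : Prop :=
  ∀ P ∈ L, P ≠ ⊥ → ∃ S : Set (H →L[ℂ] H),
    S.Finite ∧ (∀ A ∈ S, IsLatticeAtom L A) ∧ P = generatedBy L S

/-- Every ascending sequence in `L` is eventually constant. -/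
def AscendingSequencesStabilize (L : CompleteSublattice (ClosedSubmodule ℂ H)) : Prop :=
  ∀ F : ℕ → ClosedSubmodule ℂ H, (∀ n, F n ∈ L) → Monotone F → ∃ n, ∀ m, n ≤ m → F m = F n

/-- A linear manifold (not necessarily closed) that is invariant under `Alg L`. -/
def IsInvariantManifold (L : CompleteSublattice (ClosedSubmodule ℂ H)) (M : Submodule ℂ H) :
    Prop :=
  ∀ T ∈ Alg L, ∀ x ∈ M, T x ∈ M

/-- An invariant linear manifold that is the range of a bounded operator on `H`. -/
def IsInvariantOperatorRange (L : CompleteSublattice (ClosedSubmodule ℂ H))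
    (M : Submodule ℂ H) : Prop :=
  IsInvariantManifold L M ∧ ∃ T : H →L[ℂ] H, (M : Set H) = Set.range T

/-- Every non-zero element `P` of `L` has an immediate predecessor: an element `Q < P` of `L` with
no element of `L` strictly in between. -/
def HasImmediatePredecessors (L : CompleteSublattice (ClosedSubmodule ℂ H)) : Prop :=
  ∀ P ∈ L, P ≠ ⊥ → ∃ Q ∈ L, Q < P ∧ ∀ F ∈ L, ¬ (Q < F ∧ F < P)

end SubspaceLattice

/-!
Suppose `L` contains a strictly increasing sequence `F 0 < F 1 < ⋯`. For weights `t` decreasing to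
`0`, the operator `√(∑ (t n - t (n + 1)) P_{F n})` has an invariant range: by Douglas' theorem
`range A ⊆ range B` means `‖A* z‖ ≤ c ‖B* z‖` for all `z`, and the adjoint of an element of `Alg L`
shrinks every `‖P_{F n} z‖` up to its norm. Vectors in the gaps `F (n + 1) ⊖ F n` show that this
range is not closed when the weights are positive, and that inclusion between two such ranges forces
one weight sequence to be `O` of the other; two sequences of inverse factorials that overtake each
other infinitely often give incomparable ranges.

Conversely, if ascending sequences stabilize, every element of `L` has lower covers `Q ⋖ P` above
any smaller element, and `P_P - P_Q` is an atom. If an atom `A` does not vanish on `x`, the rank-one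
operators `z ↦ ⟪A x, A z⟫ y`, for `y` in the element generated by `A`, lie in `Alg L`, so an
invariant manifold containing `x` contains that element. Hence the largest element of `L` contained
in an invariant manifold is the whole manifold.
-/

namespace SubspaceLattice

open Asymptotics ContinuousLinearMap Filter Topology
open scoped InnerProduct InnerProductSpace Nat

section RangeInclusion

variable {𝕜 E F G : Type*} [RCLike 𝕜]
  [NormedAddCommGroup E] [InnerProductSpace 𝕜 E]
  [NormedAddCommGroup F] [InnerProductSpace 𝕜 F] [CompleteSpace F]
  [NormedAddCommGroup G] [InnerProductSpace 𝕜 G] [CompleteSpace G]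

theorem exists_forall_eq_inner_of_norm_le (B : E →L[𝕜] F) {f : E →ₗ[𝕜] 𝕜} {c : ℝ}
    (h : ∀ y, ‖f y‖ ≤ c * ‖B y‖) : ∃ z, ∀ y, f y = ⟪z, B y⟫_𝕜 := by
  obtain ⟨l, hl⟩ : f ∈ B.toLinearMap.dualMap.range := by
    rw [LinearMap.range_dualMap_eq_dualAnnihilator_ker, Submodule.mem_dualAnnihilator]
    intro y (hy : B y = 0)
    simpa [hy] using h y
  have hlB (y : E) : l (B y) = f y := LinearMap.congr_fun hl y
  have hbound : ∀ v : B.range, ‖l.domRestrict B.range v‖ ≤ c * ‖v‖ := by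
    rintro ⟨_, y, rfl⟩
    simpa [hlB] using h y
  obtain ⟨g, hg, -⟩ := exists_extension_norm_eq _ ((l.domRestrict B.range).mkContinuous c hbound)
  refine ⟨(InnerProductSpace.toDual 𝕜 F).symm g, fun y => ?_⟩
  rw [InnerProductSpace.toDual_symm_apply, ← hlB]
  exact (hg ⟨B y, y, rfl⟩).symm

variable [CompleteSpace E]

theorem mem_range_iff_exists_norm_inner_le (B : E →L[𝕜] F) {x : F} :
    x ∈ B.range ↔ ∃ c, ∀ y, ‖⟪x, y⟫_𝕜‖ ≤ c * ‖(B†) y‖ := by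
  constructor
  · rintro ⟨z, rfl⟩
    refine ⟨‖z‖, fun y => ?_⟩
    rw [coe_coe, ← adjoint_inner_right]
    exact norm_inner_le_norm z _
  · rintro ⟨c, hc⟩
    obtain ⟨z, hz⟩ := exists_forall_eq_inner_of_norm_le (B†) (f := innerₛₗ 𝕜 x) hc
    refine ⟨z, ext_inner_right 𝕜 fun y => ?_⟩
    rw [coe_coe, ← adjoint_inner_right, ← hz, innerₛₗ_apply_apply]

theorem exists_norm_adjoint_le_of_range_le {A : E →L[𝕜] G} {B : F →L[𝕜] G}
    (h : A.range ≤ B.range) : ∃ c, ∀ z, ‖(A†) z‖ ≤ c * ‖(B†) z‖ := by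
  have hpt (y : E) : ∃ c, ∀ z, ‖⟪(A†) z, y⟫_𝕜‖ ≤ ‖(B†) z‖ * c := by
    obtain ⟨c, hc⟩ := (mem_range_iff_exists_norm_inner_le B).1 (h ⟨y, rfl⟩)
    refine ⟨c, fun z => ?_⟩
    rw [adjoint_inner_left, norm_inner_symm, mul_comm]
    exact hc z
  have hker {z : G} (hz : ‖(B†) z‖ = 0) : (A†) z = 0 := by
    obtain ⟨c, hc⟩ := hpt ((A†) z)
    simpa [hz] using hc z
  let g (z : G) : StrongDual 𝕜 E := (‖(B†) z‖ : 𝕜)⁻¹ • innerSL 𝕜 ((A†) z)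
  obtain ⟨C, hC⟩ := banach_steinhaus (g := g) fun y => by
    obtain ⟨c, hc⟩ := hpt y
    refine ⟨max c 0, fun z => ?_⟩
    simp only [g, smul_apply, norm_smul, norm_inv, RCLike.norm_ofReal, abs_norm,
      innerSL_apply_apply]
    exact inv_mul_le_of_le_mul₀ (norm_nonneg _) (le_max_right _ _)
      ((hc z).trans (by gcongr; exact le_max_left _ _))
  refine ⟨C, fun z => ?_⟩
  rcases (norm_nonneg ((B†) z)).eq_or_lt with hz | hz
  · simp [hker hz.symm, ← hz]
  · have hgz := hC z
    simp only [g, norm_smul, norm_inv, RCLike.norm_ofReal, abs_norm, innerSL_apply_norm] at hgz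
    rwa [inv_mul_le_iff₀ hz, mul_comm] at hgz

theorem range_le_range_iff_exists_norm_adjoint_le (A : E →L[𝕜] G) (B : F →L[𝕜] G) :
    A.range ≤ B.range ↔ ∃ c, ∀ z, ‖(A†) z‖ ≤ c * ‖(B†) z‖ := by
  refine ⟨exists_norm_adjoint_le_of_range_le, ?_⟩
  rintro ⟨c, hc⟩ _ ⟨y, rfl⟩
  refine (mem_range_iff_exists_norm_inner_le B).2 ⟨‖y‖ * c, fun z => ?_⟩
  rw [coe_coe, ← adjoint_inner_right, mul_assoc]
  exact (norm_inner_le_norm _ _).trans (by gcongr; exact hc z)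

end RangeInclusion

section Weights

theorem hasSum_sub_succ {t : ℕ → ℝ} (ht : Antitone t) (ht₀ : Tendsto t atTop (𝓝 0))
    (n : ℕ) : HasSum (fun k => t (k + n) - t (k + n + 1)) (t n) := by
  rw [hasSum_iff_tendsto_nat_of_nonneg fun k => sub_nonneg.2 (ht (Nat.le_succ _))]
  have htel (N : ℕ) : ∑ k ∈ Finset.range N, (t (k + n) - t (k + n + 1)) = t n - t (N + n) := by
    simpa [add_right_comm] using Finset.sum_range_sub' (fun k => t (k + n)) N
  simpa only [htel, sub_zero] using ((tendsto_add_atTop_iff_nat n).2 ht₀).const_sub (t n)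

variable {a b : ℕ → ℕ}

theorem antitone_inv_factorial (ha : Monotone a) : Antitone fun n => ((a n)! : ℝ)⁻¹ :=
  fun _ _ h => inv_anti₀ (by positivity) (by exact_mod_cast Nat.factorial_le (ha h))

theorem tendsto_inv_factorial (ha : Tendsto a atTop atTop) :
    Tendsto (fun n => ((a n)! : ℝ)⁻¹) atTop (𝓝 0) := by
  simpa [Function.comp_def] using (FloorSemiring.tendsto_pow_div_factorial_atTop (1 : ℝ)).comp ha

theorem not_isBigO_inv_factorial (ha : Tendsto a atTop atTop)
    (hb : ∃ᶠ n in atTop, b n = a n + 1) :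
    ¬ (fun n => ((a n)! : ℝ)⁻¹) =O[atTop] fun n => ((b n)! : ℝ)⁻¹ := by
  intro hO
  obtain ⟨c, hc⟩ := hO.bound
  obtain ⟨n, hn, hcn, hlt⟩ := (hb.and_eventually
    (hc.and ((tendsto_natCast_atTop_atTop.comp ha).eventually_gt_atTop c))).exists
  have hle : ((a n)! : ℝ)⁻¹ ≤ c / (a n + 1) * ((a n)! : ℝ)⁻¹ := by
    rw [hn, Nat.factorial_succ] at hcn
    simpa [abs_of_nonneg (by positivity : 0 ≤ (a n : ℝ) + 1), div_eq_mul_inv, mul_comm, mul_assoc,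
      mul_left_comm] using hcn
  have hone : 1 ≤ c / (a n + 1) := le_of_mul_le_mul_right ((one_mul _).trans_le hle) (by positivity)
  rw [one_le_div (by positivity)] at hone
  exact (hone.trans_lt hlt).not_ge (by simp)

end Weights

variable {H : Type*} [NormedAddCommGroup H] [InnerProductSpace ℂ H]
  {L : CompleteSublattice (ClosedSubmodule ℂ H)}

section AscendingSequences

theorem wellFoundedGT_iff_ascendingSequencesStabilize :
    WellFoundedGT L ↔ AscendingSequencesStabilize L := by
  rw [wellFoundedGT_iff_monotone_chain_condition]
  constructor
  · intro h F hF hmono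
    obtain ⟨n, hn⟩ := h ⟨fun n => ⟨F n, hF n⟩, fun i j hij => hmono hij⟩
    exact ⟨n, fun m hm => (congrArg Subtype.val (hn m hm)).symm⟩
  · intro h a
    obtain ⟨n, hn⟩ := h (fun n => a n) (fun n => (a n).2) fun i j hij => a.monotone hij
    exact ⟨n, fun m hm => Subtype.ext (hn m hm).symm⟩

theorem exists_strictMono_of_not_ascendingSequencesStabilize
    (h : ¬ AscendingSequencesStabilize L) :
    ∃ F : ℕ → ClosedSubmodule ℂ H, (∀ n, F n ∈ L) ∧ StrictMono F := by
  rw [← wellFoundedGT_iff_ascendingSequencesStabilize, WellFoundedGT, isWellFounded_iff,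
    RelEmbedding.wellFounded_iff_isEmpty, not_isEmpty_iff] at h
  obtain ⟨f⟩ := h
  exact ⟨fun n => f n, fun n => (f n).2,
    strictMono_nat_of_lt_succ fun n => f.map_rel_iff.2 n.lt_succ_self⟩

theorem ascendingSequencesStabilize_of_forall_exists_iSup_le
    (h : ∀ F : ℕ → ClosedSubmodule ℂ H, (∀ n, F n ∈ L) → Monotone F → ⨆ n, F n ≠ ⊥ →
      ∃ n, ⨆ m, F m ≤ F n) : AscendingSequencesStabilize L := by
  intro F hF hmono
  obtain ⟨n, hn⟩ : ∃ n, ⨆ m, F m ≤ F n := by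
    by_cases hbot : ⨆ n, F n = ⊥
    · exact ⟨0, hbot.trans_le bot_le⟩
    · exact h F hF hmono hbot
  exact ⟨n, fun m hm => ((le_iSup F m).trans hn).antisymm (hmono hm)⟩

theorem exists_covBy_of_notMem (hL : AscendingSequencesStabilize L) {E : L} {x : H}
    (hx : x ∉ E.1) : ∃ P Q : L, E ≤ Q ∧ Q ⋖ P ∧ x ∈ P.1 ∧ x ∉ Q.1 := by
  have := wellFoundedGT_iff_ascendingSequencesStabilize.2 hL
  let P : L := sInf {F | E ≤ F ∧ x ∈ F.1}
  have hxP : x ∈ P.1 := by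
    rw [CompleteSublattice.coe_sInf, ClosedSubmodule.mem_sInf]
    rintro _ ⟨F, hF, rfl⟩
    exact hF.2
  have hEP : E < P := (le_sInf fun F hF => hF.1).lt_of_ne fun h => hx (h ▸ hxP)
  obtain ⟨Q, hEQ, hQP⟩ := exists_le_covBy_of_lt hEP
  exact ⟨P, Q, hEQ, hQP, hxP, fun hxQ => hQP.lt.not_ge (sInf_le ⟨hEQ, hxQ⟩)⟩

theorem hasImmediatePredecessors_of_ascendingSequencesStabilize
    (hL : AscendingSequencesStabilize L) : HasImmediatePredecessors L := by
  intro P hP hne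
  have := wellFoundedGT_iff_ascendingSequencesStabilize.2 hL
  have hlt : (⊥ : L) < ⟨P, hP⟩ := bot_lt_iff_ne_bot.2 fun h => hne (congrArg Subtype.val h)
  obtain ⟨Q, -, hQP⟩ := exists_le_covBy_of_lt hlt
  exact ⟨Q, Q.2, hQP.lt, fun F hF h => hQP.2 (c := ⟨F, hF⟩) h.1 h.2⟩

theorem IsNest.ascendingSequencesStabilize_of_hasImmediatePredecessors (hL : IsNest L)
    (h : HasImmediatePredecessors L) : AscendingSequencesStabilize L := by
  refine ascendingSequencesStabilize_of_forall_exists_iSup_le fun F hF _ hbot => ?_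
  obtain ⟨Q, hQ, hQP, hcov⟩ := h _ (L.sSupClosed (Set.range_subset_iff.2 hF)) hbot
  obtain ⟨n, hn⟩ : ∃ n, ¬ F n ≤ Q := by
    by_contra! hall
    exact hQP.not_ge (iSup_le hall)
  have hQF : Q < F n := lt_of_le_not_ge ((hL _ (hF n) _ hQ).resolve_left hn) hn
  refine ⟨n, le_of_eq (by_contra fun hne => ?_)⟩
  exact hcov _ (hF n) ⟨hQF, (le_iSup F n).lt_of_ne' hne⟩

end AscendingSequences

section GeneratedBy

variable {F : ClosedSubmodule ℂ H} {S T : Set (H →L[ℂ] H)}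

theorem generatedBy_mem (L : CompleteSublattice (ClosedSubmodule ℂ H)) (S : Set (H →L[ℂ] H)) :
    generatedBy L S ∈ L :=
  L.sInfClosed fun _ h => h.1

theorem apply_mem_generatedBy {A : H →L[ℂ] H} (hA : A ∈ S) (x : H) : A x ∈ generatedBy L S :=
  ClosedSubmodule.mem_sInf.2 fun _ hF => hF.2 A hA x

theorem generatedBy_le_iff (hF : F ∈ L) : generatedBy L S ≤ F ↔ ∀ A ∈ S, ∀ x, A x ∈ F :=
  ⟨fun h _ hA x => h (apply_mem_generatedBy hA x), fun h => sInf_le ⟨hF, h⟩⟩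

theorem generatedBy_mono (h : S ⊆ T) : generatedBy L S ≤ generatedBy L T :=
  (generatedBy_le_iff (generatedBy_mem L T)).2 fun _ hA => apply_mem_generatedBy (h hA)

end GeneratedBy

variable [CompleteSpace H]

section Proj

variable {E F : ClosedSubmodule ℂ H} {x : H}

theorem proj_mem (E : ClosedSubmodule ℂ H) (x : H) : proj E x ∈ E :=
  E.toSubmodule.starProjection_apply_mem x

theorem proj_eq_self_iff : proj E x = x ↔ x ∈ E :=
  E.toSubmodule.starProjection_eq_self_iff

theorem isSelfAdjoint_proj (E : ClosedSubmodule ℂ H) : IsSelfAdjoint (proj E) :=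
  isSelfAdjoint_starProjection E.toSubmodule

theorem proj_proj_of_le (h : E ≤ F) (x : H) : proj E (proj F x) = proj E x :=
  DFunLike.congr_fun (Submodule.starProjection_comp_starProjection_of_le h) x

theorem norm_proj_le (E : ClosedSubmodule ℂ H) (x : H) : ‖proj E x‖ ≤ ‖x‖ :=
  E.toSubmodule.norm_starProjection_apply_le x

theorem norm_proj_mono (h : E ≤ F) (x : H) : ‖proj E x‖ ≤ ‖proj F x‖ := by
  rw [← proj_proj_of_le h]
  exact norm_proj_le E _

theorem exists_mem_ne_zero_proj_eq_zero (h : E < F) : ∃ z ∈ F, z ≠ 0 ∧ proj E z = 0 := by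
  obtain ⟨x, hxF, hxE⟩ := SetLike.exists_of_lt h
  refine ⟨x - proj E x, F.toSubmodule.sub_mem hxF (h.le (proj_mem E x)), ?_, ?_⟩
  · exact sub_ne_zero.2 fun hx => hxE (proj_eq_self_iff.1 hx.symm)
  · rw [map_sub, proj_eq_self_iff.2 (proj_mem E x), sub_self]

theorem proj_adjoint_proj {T : H →L[ℂ] H} (hT : ∀ y ∈ E, T y ∈ E) (x : H) :
    proj E ((T†) (proj E x)) = proj E ((T†) x) := by
  have hTE : T * proj E = proj E * T * proj E := by
    ext y
    exact (proj_eq_self_iff.2 (hT _ (proj_mem E y))).symm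
  have h := congrArg star hTE
  simp only [star_mul, (isSelfAdjoint_proj E).star_eq] at h
  exact (DFunLike.congr_fun h x).symm

end Proj

section ChainOperator

theorem norm_sqrt_apply_sq {D : H →L[ℂ] H} (hD : 0 ≤ D) (x : H) :
    ‖CFC.sqrt D x‖ ^ 2 = RCLike.re ⟪x, D x⟫_ℂ := by
  have hstar : star (CFC.sqrt D) * CFC.sqrt D = D := by
    rw [(CFC.sqrt_nonneg D).isSelfAdjoint.star_eq, CFC.sqrt_mul_sqrt_self D hD]
  rw [apply_norm_sq_eq_inner_adjoint_right]
  exact congrArg (fun T : H →L[ℂ] H => RCLike.re ⟪x, T x⟫_ℂ) hstar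

/-- The square root of `∑ n, (t n - t (n + 1)) • proj (F n)`. For an increasing chain `F` and
weights `t` decreasing to `0`, it multiplies by `√(t (n + 1))` on the gap `F (n + 1) ⊖ F n`, so the
decay of `t` measures how small its range is. -/
noncomputable def chainOperator (F : ℕ → ClosedSubmodule ℂ H) (t : ℕ → ℝ) : H →L[ℂ] H :=
  CFC.sqrt (∑' n, (t n - t (n + 1)) • proj (F n))

theorem adjoint_chainOperator (F : ℕ → ClosedSubmodule ℂ H) (t : ℕ → ℝ) :
    (chainOperator F t)† = chainOperator F t :=
  (CFC.sqrt_nonneg _).isSelfAdjoint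

variable {F : ℕ → ClosedSubmodule ℂ H} {t : ℕ → ℝ}

theorem hasSum_norm_chainOperator_sq (F : ℕ → ClosedSubmodule ℂ H) (ht : Antitone t)
    (ht₀ : Tendsto t atTop (𝓝 0)) (x : H) :
    HasSum (fun n => (t n - t (n + 1)) * ‖proj (F n) x‖ ^ 2) (‖chainOperator F t x‖ ^ 2) := by
  have hw (n : ℕ) : 0 ≤ t n - t (n + 1) := sub_nonneg.2 (ht n.le_succ)
  have hsum : Summable fun n => (t n - t (n + 1)) • proj (F n) := by
    refine .of_norm_bounded (hasSum_sub_succ ht ht₀ 0).summable fun n => ?_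
    rw [norm_smul, Real.norm_of_nonneg (hw n)]
    exact mul_le_of_le_one_right (hw n) (Submodule.starProjection_norm_le _)
  have hnonneg : 0 ≤ ∑' n, (t n - t (n + 1)) • proj (F n) :=
    tsum_nonneg fun n => smul_nonneg (hw n) isStarProjection_starProjection.nonneg
  have hterm (n : ℕ) : RCLike.re ⟪x, ((t n - t (n + 1)) • proj (F n)) x⟫_ℂ =
      (t n - t (n + 1)) * ‖proj (F n) x‖ ^ 2 := by
    rw [smul_apply, inner_smul_right_eq_smul, RCLike.smul_re, ← inner_conj_symm, RCLike.conj_re]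
    exact congrArg _ (Submodule.re_inner_starProjection_eq_normSq _ x)
  rw [chainOperator, norm_sqrt_apply_sq hnonneg]
  simpa only [innerSL_apply_apply, apply_apply, hterm] using RCLike.hasSum_re ℂ <|
    (innerSL ℂ x).hasSum ((ContinuousLinearMap.apply ℂ H x).hasSum hsum.hasSum)

theorem hasSum_nat_add_norm_chainOperator_sq (F : ℕ → ClosedSubmodule ℂ H) (ht : Antitone t)
    (ht₀ : Tendsto t atTop (𝓝 0)) (x : H) (n : ℕ) :
    HasSum (fun k => (t (k + n) - t (k + n + 1)) * ‖proj (F (k + n)) x‖ ^ 2)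
      (‖chainOperator F t x‖ ^ 2 -
        ∑ k ∈ Finset.range n, (t k - t (k + 1)) * ‖proj (F k) x‖ ^ 2) :=
  (hasSum_nat_add_iff' n).2 (hasSum_norm_chainOperator_sq F ht ht₀ x)

theorem mul_norm_proj_sq_le_norm_chainOperator_sq (hF : Monotone F) (ht : Antitone t)
    (ht₀ : Tendsto t atTop (𝓝 0)) (n : ℕ) (x : H) :
    t n * ‖proj (F n) x‖ ^ 2 ≤ ‖chainOperator F t x‖ ^ 2 := by
  have hw (k : ℕ) : 0 ≤ t k - t (k + 1) := sub_nonneg.2 (ht k.le_succ)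
  refine (hasSum_le (fun k => ?_) ((hasSum_sub_succ ht ht₀ n).mul_right _)
    (hasSum_nat_add_norm_chainOperator_sq F ht ht₀ x n)).trans
    (sub_le_self _ (Finset.sum_nonneg fun k _ => mul_nonneg (hw k) (sq_nonneg _)))
  have := hw (k + n)
  gcongr
  exact norm_proj_mono (hF (Nat.le_add_left n k)) x

theorem norm_chainOperator_sq_le_of_proj_eq_zero (hF : Monotone F) (ht : Antitone t)
    (ht₀ : Tendsto t atTop (𝓝 0)) {n : ℕ} {x : H} (hx : proj (F n) x = 0) :
    ‖chainOperator F t x‖ ^ 2 ≤ t (n + 1) * ‖x‖ ^ 2 := by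
  have hzero : ∑ k ∈ Finset.range (n + 1), (t k - t (k + 1)) * ‖proj (F k) x‖ ^ 2 = 0 := by
    refine Finset.sum_eq_zero fun k hk => ?_
    have hkn : F k ≤ F n := hF (Nat.lt_succ_iff.1 (Finset.mem_range.1 hk))
    simp [← proj_proj_of_le hkn x, hx]
  have hsum := hasSum_nat_add_norm_chainOperator_sq F ht ht₀ x (n + 1)
  rw [hzero, sub_zero] at hsum
  refine hasSum_le (fun k => ?_) hsum ((hasSum_sub_succ ht ht₀ (n + 1)).mul_right _)
  have : 0 ≤ t (k + (n + 1)) - t (k + (n + 1) + 1) := sub_nonneg.2 (ht (Nat.le_succ _))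
  gcongr
  exact norm_proj_le _ x

theorem isInvariantOperatorRange_range_chainOperator (hFL : ∀ n, F n ∈ L) (ht : Antitone t)
    (ht₀ : Tendsto t atTop (𝓝 0)) : IsInvariantOperatorRange L (chainOperator F t).range := by
  refine ⟨?_, chainOperator F t, rfl⟩
  intro S hS
  suffices h : (S ∘L chainOperator F t).range ≤ (chainOperator F t).range by
    rintro _ ⟨y, rfl⟩
    exact h ⟨y, rfl⟩
  refine (range_le_range_iff_exists_norm_adjoint_le _ _).2 ⟨‖S†‖, fun z => ?_⟩
  rw [adjoint_comp, adjoint_chainOperator, comp_apply]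
  refine le_of_sq_le_sq ?_ (by positivity)
  rw [mul_pow]
  refine hasSum_le (fun n => ?_) (hasSum_norm_chainOperator_sq F ht ht₀ _)
    ((hasSum_norm_chainOperator_sq F ht ht₀ z).mul_left _)
  have hproj : ‖proj (F n) ((S†) z)‖ ≤ ‖S†‖ * ‖proj (F n) z‖ := by
    rw [← proj_adjoint_proj (hS _ (hFL n))]
    exact (norm_proj_le _ _).trans ((S†).le_opNorm _)
  have : 0 ≤ t n - t (n + 1) := sub_nonneg.2 (ht n.le_succ)
  rw [mul_left_comm, ← mul_pow]
  gcongr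

theorem le_range_chainOperator (hF : Monotone F) (ht : Antitone t) (ht₀ : Tendsto t atTop (𝓝 0))
    {n : ℕ} (hn : 0 < t n) : (F n).toSubmodule ≤ (chainOperator F t).range := by
  suffices h : (proj (F n)).range ≤ (chainOperator F t).range from
    fun x hx => h ⟨x, proj_eq_self_iff.2 hx⟩
  refine (range_le_range_iff_exists_norm_adjoint_le _ _).2 ⟨√(t n)⁻¹, fun z => ?_⟩
  rw [(isSelfAdjoint_proj (F n)).adjoint_eq, adjoint_chainOperator]
  refine le_of_sq_le_sq ?_ (by positivity)
  rw [mul_pow, Real.sq_sqrt (by positivity), le_inv_mul_iff₀ hn]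
  exact mul_norm_proj_sq_le_norm_chainOperator_sq hF ht ht₀ n z

theorem exists_norm_adjoint_sq_le_of_range_le_range_chainOperator (hF : Monotone F)
    (ht : Antitone t) (ht₀ : Tendsto t atTop (𝓝 0)) {A : H →L[ℂ] H}
    (h : A.range ≤ (chainOperator F t).range) :
    ∃ c, ∀ n z, proj (F n) z = 0 → ‖(A†) z‖ ^ 2 ≤ c * t (n + 1) * ‖z‖ ^ 2 := by
  obtain ⟨c, hc⟩ := (range_le_range_iff_exists_norm_adjoint_le _ _).1 h
  refine ⟨c ^ 2, fun n z hz => ?_⟩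
  calc ‖(A†) z‖ ^ 2 ≤ (c * ‖chainOperator F t z‖) ^ 2 := by
        gcongr
        simpa only [adjoint_chainOperator] using hc z
    _ = c ^ 2 * ‖chainOperator F t z‖ ^ 2 := mul_pow ..
    _ ≤ c ^ 2 * (t (n + 1) * ‖z‖ ^ 2) := by
        gcongr
        exact norm_chainOperator_sq_le_of_proj_eq_zero hF ht ht₀ hz
    _ = c ^ 2 * t (n + 1) * ‖z‖ ^ 2 := (mul_assoc ..).symm

theorem not_isClosed_range_chainOperator (hF : StrictMono F) (ht : Antitone t)
    (ht₀ : Tendsto t atTop (𝓝 0)) (hpos : ∀ n, 0 < t n) :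
    ¬ IsClosed ((chainOperator F t).range : Set H) := by
  intro hcl
  let R : ClosedSubmodule ℂ H := ⟨(chainOperator F t).range, hcl⟩
  have hRrange : (proj R).range ≤ (chainOperator F t).range := by
    rintro _ ⟨y, rfl⟩
    exact proj_mem R y
  obtain ⟨c, hc⟩ :=
    exists_norm_adjoint_sq_le_of_range_le_range_chainOperator hF.monotone ht ht₀ hRrange
  have hone (n : ℕ) : 1 ≤ c * t (n + 1) := by
    obtain ⟨z, hzF, hz, hzn⟩ := exists_mem_ne_zero_proj_eq_zero (hF n.lt_succ_self)
    have hzR : z ∈ R := le_range_chainOperator hF.monotone ht ht₀ (hpos (n + 1)) hzF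
    have hcz := hc n z hzn
    rw [(isSelfAdjoint_proj R).adjoint_eq, proj_eq_self_iff.2 hzR] at hcz
    exact (le_mul_iff_one_le_left (by positivity)).1 hcz
  have hlim := ((tendsto_add_atTop_iff_nat 1).2 ht₀).const_mul c
  rw [mul_zero] at hlim
  exact zero_lt_one.not_ge (ge_of_tendsto' hlim hone)

theorem isBigO_of_range_chainOperator_le {s : ℕ → ℝ} (hF : StrictMono F)
    (hs : Antitone s) (hs₀ : Tendsto s atTop (𝓝 0)) (ht : Antitone t)
    (ht₀ : Tendsto t atTop (𝓝 0)) (h : (chainOperator F s).range ≤ (chainOperator F t).range) :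
    s =O[atTop] t := by
  obtain ⟨c, hc⟩ := exists_norm_adjoint_sq_le_of_range_le_range_chainOperator hF.monotone ht ht₀ h
  have hst (n : ℕ) : s (n + 1) ≤ c * t (n + 1) := by
    obtain ⟨z, hzF, hz, hzn⟩ := exists_mem_ne_zero_proj_eq_zero (hF n.lt_succ_self)
    have hsz := mul_norm_proj_sq_le_norm_chainOperator_sq hF.monotone hs hs₀ (n + 1) z
    rw [proj_eq_self_iff.2 hzF] at hsz
    have htz := hc n z hzn
    rw [adjoint_chainOperator] at htz
    exact le_of_mul_le_mul_right (hsz.trans htz) (by positivity)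
  refine .of_bound c (eventually_atTop.2 ⟨1, fun n hn => ?_⟩)
  obtain ⟨m, rfl⟩ := Nat.exists_eq_add_of_le' hn
  rw [Real.norm_of_nonneg (hs.le_of_tendsto hs₀ _), Real.norm_of_nonneg (ht.le_of_tendsto ht₀ _)]
  exact hst m

theorem exists_isInvariantOperatorRange_not_isClosed (hFL : ∀ n, F n ∈ L) (hF : StrictMono F) :
    ∃ M : Submodule ℂ H, IsInvariantOperatorRange L M ∧ ¬ IsClosed (M : Set H) := by
  have ht : Antitone fun n : ℕ => (1 / 2 : ℝ) ^ n := pow_right_anti₀ (by norm_num) (by norm_num)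
  have ht₀ : Tendsto (fun n : ℕ => (1 / 2 : ℝ) ^ n) atTop (𝓝 0) :=
    tendsto_pow_atTop_nhds_zero_of_lt_one (by norm_num) (by norm_num)
  exact ⟨_, isInvariantOperatorRange_range_chainOperator hFL ht ht₀,
    not_isClosed_range_chainOperator hF ht ht₀ fun n => by positivity⟩

theorem exists_isInvariantOperatorRange_incomparable (hFL : ∀ n, F n ∈ L) (hF : StrictMono F) :
    ∃ M N : Submodule ℂ H, IsInvariantOperatorRange L M ∧ IsInvariantOperatorRange L N ∧
      ¬ M ≤ N ∧ ¬ N ≤ M := by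
  -- `a` and `b` run `1, 1, 3, 3, 5, …` and `0, 2, 2, 4, 4, …`, overtaking each other in turn.
  let a (n : ℕ) := 2 * (n / 2) + 1
  let b (n : ℕ) := 2 * ((n + 1) / 2)
  have ha : Monotone a := fun m n h => by simp only [a]; omega
  have hb : Monotone b := fun m n h => by simp only [b]; omega
  have ha_top : Tendsto a atTop atTop :=
    tendsto_atTop_mono (fun n => by simp only [a, id]; omega) tendsto_id
  have hb_top : Tendsto b atTop atTop :=
    tendsto_atTop_mono (fun n => by simp only [b, id]; omega) tendsto_id
  have hba : ∃ᶠ n in atTop, b n = a n + 1 :=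
    frequently_atTop.2 fun n => ⟨2 * n + 1, by omega, by simp only [a, b]; omega⟩
  have hab : ∃ᶠ n in atTop, a n = b n + 1 :=
    frequently_atTop.2 fun n => ⟨2 * n, by omega, by simp only [a, b]; omega⟩
  have hs := antitone_inv_factorial ha
  have hs₀ := tendsto_inv_factorial ha_top
  have ht := antitone_inv_factorial hb
  have ht₀ := tendsto_inv_factorial hb_top
  exact ⟨_, _, isInvariantOperatorRange_range_chainOperator hFL hs hs₀,
    isInvariantOperatorRange_range_chainOperator hFL ht ht₀,
    fun h => not_isBigO_inv_factorial ha_top hba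
      (isBigO_of_range_chainOperator_le hF hs hs₀ ht ht₀ h),
    fun h => not_isBigO_inv_factorial hb_top hab
      (isBigO_of_range_chainOperator_le hF ht ht₀ hs hs₀ h)⟩

end ChainOperator

section Atoms

variable {A : H →L[ℂ] H} {F : ClosedSubmodule ℂ H}

theorem mul_proj_eq_zero_iff : A * proj F = 0 ↔ ∀ x ∈ F, A x = 0 := by
  refine ⟨fun h x hx => ?_, fun h => ext fun x => h _ (proj_mem F x)⟩
  rw [← proj_eq_self_iff.2 hx]
  exact DFunLike.congr_fun h x

theorem mul_proj_eq_self_iff (hA : IsSelfAdjoint A) : A * proj F = A ↔ ∀ x, A x ∈ F := by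
  rw [← star_inj, star_mul, hA.star_eq, (isSelfAdjoint_proj F).star_eq, ContinuousLinearMap.ext_iff]
  exact forall_congr' fun x => proj_eq_self_iff

namespace IsLatticeAtom

theorem isSelfAdjoint (hA : IsLatticeAtom L A) : IsSelfAdjoint A := by
  obtain ⟨⟨P, -, Q, -, -, rfl⟩, -⟩ := hA
  exact (isSelfAdjoint_proj P).sub (isSelfAdjoint_proj Q)

theorem ne_zero (hA : IsLatticeAtom L A) : A ≠ 0 := by
  obtain ⟨⟨P, -, Q, -, hQP, rfl⟩, -⟩ := hA
  obtain ⟨z, hzP, hz, hzQ⟩ := exists_mem_ne_zero_proj_eq_zero hQP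
  intro h
  have hz₀ := DFunLike.congr_fun h z
  rw [sub_apply, hzQ, sub_zero, proj_eq_self_iff.2 hzP] at hz₀
  exact hz hz₀

theorem forall_eq_zero_or_forall_mem (hA : IsLatticeAtom L A) (hF : F ∈ L) :
    (∀ x ∈ F, A x = 0) ∨ ∀ x, A x ∈ F := by
  rw [← mul_proj_eq_zero_iff, ← mul_proj_eq_self_iff hA.isSelfAdjoint]
  exact hA.2 F hF

theorem exists_forall_mem_of_forall_mem_iSup {ι : Sort*} {F : ι → ClosedSubmodule ℂ H}
    (hA : IsLatticeAtom L A) (hF : ∀ i, F i ∈ L) (h : ∀ x, A x ∈ ⨆ i, F i) :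
    ∃ i, ∀ x, A x ∈ F i := by
  by_contra! hnot
  have hker : ⨆ i, F i ≤ (⊥ : ClosedSubmodule ℂ H).comap A := iSup_le fun i =>
    (hA.forall_eq_zero_or_forall_mem (hF i)).resolve_right fun hi => (hnot i).elim fun x hx =>
      hx (hi x)
  refine hA.ne_zero (ext fun x => ?_)
  have hAA : A (A x) = 0 := hker (h x)
  rw [zero_apply, ← inner_self_eq_zero (𝕜 := ℂ), ← adjoint_inner_left, hA.isSelfAdjoint.adjoint_eq,
    hAA, inner_zero_left]

theorem generatedBy_le_of_isInvariantManifold (hA : IsLatticeAtom L A) {M : Submodule ℂ H}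
    (hM : IsInvariantManifold L M) {x : H} (hx : x ∈ M) (hAx : A x ≠ 0) :
    (generatedBy L {A}).toSubmodule ≤ M := by
  intro y hy
  have hT : ((innerSL ℂ (A x)) ∘L A).smulRight y ∈ Alg L := by
    intro F hF z hz
    change ⟪A x, A z⟫_ℂ • y ∈ F
    rcases hA.forall_eq_zero_or_forall_mem hF with hzero | hmem
    · simp [hzero z hz]
    · exact F.toSubmodule.smul_mem _ ((generatedBy_le_iff hF).2 (by simpa using hmem) hy)
  exact (M.smul_mem_iff (inner_self_ne_zero.2 hAx)).1 (hM _ hT x hx)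

end IsLatticeAtom

end Atoms

section CommutativeSubspaceLattice

variable {E F P Q : ClosedSubmodule ℂ H}

theorem proj_mem_of_commute (h : Commute (proj E) (proj F)) {x : H} (hx : x ∈ F) :
    proj E x ∈ F := by
  rw [← proj_eq_self_iff.2 hx, show proj E (proj F x) = proj F (proj E x) from
    DFunLike.congr_fun h.eq x]
  exact proj_mem _ _

theorem mem_sup_iff_sub_proj_mem (h : Commute (proj E) (proj F)) {x : H} :
    x ∈ E ⊔ F ↔ x - proj E x ∈ F := by
  constructor
  · have hle : E ⊔ F ≤ F.comap (1 - proj E) := by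
      refine sup_le (fun y hy => ?_) fun y hy => ?_
      · change y - proj E y ∈ F
        rw [proj_eq_self_iff.2 hy, sub_self]
        exact F.toSubmodule.zero_mem
      · exact F.toSubmodule.sub_mem hy (proj_mem_of_commute h hy)
    exact fun hx => hle hx
  · intro hx
    rw [← add_sub_cancel (proj E x) x]
    exact add_mem ((le_sup_left : E ≤ E ⊔ F) (proj_mem E x)) ((le_sup_right : F ≤ E ⊔ F) hx)

theorem toSubmodule_sup_le_of_commute (h : Commute (proj E) (proj F)) {M : Submodule ℂ H}
    (hE : E.toSubmodule ≤ M) (hF : F.toSubmodule ≤ M) : (E ⊔ F).toSubmodule ≤ M := by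
  intro x hx
  rw [← add_sub_cancel (proj E x) x]
  exact M.add_mem (hE (proj_mem E x)) (hF ((mem_sup_iff_sub_proj_mem h).1 hx))

theorem forall_proj_sub_proj_mem_iff (h : Commute (proj Q) (proj F)) (hQP : Q ≤ P) :
    (∀ x, (proj P - proj Q) x ∈ F) ↔ P ≤ Q ⊔ F := by
  constructor
  · intro hmem x hx
    rw [mem_sup_iff_sub_proj_mem h]
    simpa only [sub_apply, proj_eq_self_iff.2 hx] using hmem x
  · intro hle x
    have hx := (mem_sup_iff_sub_proj_mem h).1 (hle (proj_mem P x))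
    rwa [proj_proj_of_le hQP] at hx

theorem isLatticeAtom_proj_sub_proj_of_covBy (hL : IsCSL L) {P Q : L} (h : Q ⋖ P) :
    IsLatticeAtom L (proj P.1 - proj Q.1) := by
  refine ⟨⟨P, P.2, Q, Q.2, h.lt, rfl⟩, fun F hF => ?_⟩
  rw [mul_proj_eq_zero_iff,
    mul_proj_eq_self_iff ((isSelfAdjoint_proj P.1).sub (isSelfAdjoint_proj Q.1)),
    forall_proj_sub_proj_mem_iff (hL Q Q.2 F hF) h.le]
  rcases h.eq_or_eq (c := Q ⊔ ⟨F, hF⟩ ⊓ P) le_sup_left (sup_le h.le inf_le_right) with hQ | hP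
  · left
    intro x hx
    have hFQ : (⟨F, hF⟩ ⊓ P : L) ≤ Q := sup_eq_left.1 hQ
    have hxQ : proj P.1 x ∈ Q.1 :=
      hFQ ⟨proj_mem_of_commute (hL P P.2 F hF) hx, proj_mem P.1 x⟩
    rw [sub_apply, ← proj_proj_of_le (show Q.1 ≤ P.1 from h.le), proj_eq_self_iff.2 hxQ, sub_self]
  · right
    exact (congrArg Subtype.val hP).ge.trans (sup_le_sup_left inf_le_left _)

theorem not_forall_proj_sub_proj_mem_of_covBy {P Q : L} (h : Q ⋖ P) :
    ¬ ∀ x, (proj P.1 - proj Q.1) x ∈ Q.1 := by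
  rw [forall_proj_sub_proj_mem_iff (Commute.refl _) h.le, sup_idem]
  exact h.lt.not_ge

theorem exists_isLatticeAtom_lt_generatedBy_insert (hL : IsCSL L)
    (h : AscendingSequencesStabilize L) {S : Set (H →L[ℂ] H)} {P : L}
    (hSP : generatedBy L S < P.1) : ∃ A, IsLatticeAtom L A ∧
      generatedBy L S < generatedBy L (insert A S) ∧ generatedBy L (insert A S) ≤ P.1 := by
  have := wellFoundedGT_iff_ascendingSequencesStabilize.2 h
  obtain ⟨Q, hSQ, hQP⟩ : ∃ Q : L, ⟨_, generatedBy_mem L S⟩ ≤ Q ∧ Q ⋖ P :=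
    exists_le_covBy_of_lt hSP
  refine ⟨proj P.1 - proj Q.1, isLatticeAtom_proj_sub_proj_of_covBy hL hQP,
    (generatedBy_mono (Set.subset_insert _ S)).lt_of_not_ge fun hle => ?_, ?_⟩
  · exact not_forall_proj_sub_proj_mem_of_covBy hQP fun x =>
      hSQ (hle (apply_mem_generatedBy (Set.mem_insert _ S) x))
  · rw [generatedBy_le_iff P.2, Set.forall_mem_insert]
    exact ⟨fun x => P.1.toSubmodule.sub_mem (proj_mem P.1 x) (hQP.le (proj_mem Q.1 x)),
      fun A hA x => hSP.le (apply_mem_generatedBy hA x)⟩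

theorem isHyperatomic_of_ascendingSequencesStabilize (hL : IsCSL L)
    (h : AscendingSequencesStabilize L) : IsHyperatomic L := by
  intro P hP _
  have := wellFoundedGT_iff_ascendingSequencesStabilize.2 h
  obtain ⟨E, ⟨S, hSfin, hS, hES, hSP⟩, hmax⟩ := exists_maximal_of_wellFoundedGT
    (fun E : L => ∃ S : Set (H →L[ℂ] H), S.Finite ∧ (∀ A ∈ S, IsLatticeAtom L A) ∧
      E.1 = generatedBy L S ∧ generatedBy L S ≤ P)
    ⟨⟨_, generatedBy_mem L ∅⟩, ∅, by simp, by simp, rfl, (generatedBy_le_iff hP).2 (by simp)⟩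
  refine ⟨S, hSfin, hS, by_contra fun hne => ?_⟩
  obtain ⟨A, hA, hlt, hle⟩ := exists_isLatticeAtom_lt_generatedBy_insert hL h (P := ⟨P, hP⟩)
    (hSP.lt_of_ne' hne)
  have hAE : (⟨_, generatedBy_mem L (insert A S)⟩ : L) ≤ E :=
    hmax ⟨insert A S, hSfin.insert A, Set.forall_mem_insert.2 ⟨hA, hS⟩, rfl, hle⟩
      (hES.trans_le hlt.le)
  exact (hlt.trans_le hAE).ne' hES

theorem ascendingSequencesStabilize_of_isHyperatomic (h : IsHyperatomic L) :
    AscendingSequencesStabilize L := by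
  refine ascendingSequencesStabilize_of_forall_exists_iSup_le fun F hF hmono hbot => ?_
  have hFL : ⨆ n, F n ∈ L := L.sSupClosed (Set.range_subset_iff.2 hF)
  obtain ⟨S, hSfin, hS, hgen⟩ := h _ hFL hbot
  have hmem : ∀ A ∈ S, ∀ x, A x ∈ ⨆ n, F n := (generatedBy_le_iff hFL).1 hgen.ge
  choose! k hk using fun A hA => (hS A hA).exists_forall_mem_of_forall_mem_iSup hF (hmem A hA)
  obtain ⟨n, hn⟩ := (hSfin.image k).bddAbove
  refine ⟨n, ?_⟩
  rw [hgen, generatedBy_le_iff (hF n)]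
  exact fun A hA x => hmono (hn ⟨A, hA, rfl⟩) (hk A hA x)

theorem exists_mem_toSubmodule_eq_of_isInvariantManifold (hL : IsCSL L)
    (h : AscendingSequencesStabilize L) {M : Submodule ℂ H} (hM : IsInvariantManifold L M) :
    ∃ E ∈ L, E.toSubmodule = M := by
  have := wellFoundedGT_iff_ascendingSequencesStabilize.2 h
  obtain ⟨E, hEM, hmax⟩ := exists_maximal_of_wellFoundedGT
    (fun E : L => E.1.toSubmodule ≤ M) ⟨⊥, bot_le⟩
  refine ⟨E, E.2, hEM.antisymm fun x hxM => by_contra fun hxE => ?_⟩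
  obtain ⟨P, Q, hEQ, hQP, hxP, hxQ⟩ := exists_covBy_of_notMem h hxE
  have hA := isLatticeAtom_proj_sub_proj_of_covBy hL hQP
  have hAx : (proj P.1 - proj Q.1) x ≠ 0 := by
    rw [sub_apply, proj_eq_self_iff.2 hxP, sub_ne_zero]
    exact fun hx => hxQ (proj_eq_self_iff.1 hx.symm)
  let G : L := ⟨generatedBy L {proj P.1 - proj Q.1}, generatedBy_mem L _⟩
  have hGM : G.1.toSubmodule ≤ M := hA.generatedBy_le_of_isInvariantManifold hM hxM hAx
  have hGE : G ≤ E := le_sup_right.trans <|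
    hmax (y := E ⊔ G) (toSubmodule_sup_le_of_commute (hL E E.2 G G.2) hEM hGM) le_sup_left
  exact not_forall_proj_sub_proj_mem_of_covBy hQP <|
    (generatedBy_le_iff Q.2).1 (hGE.trans hEQ) _ rfl

theorem tfae_ascendingSequencesStabilize (hL : IsCSL L) :
    List.TFAE [
      IsHyperatomic L,
      AscendingSequencesStabilize L,
      ∀ M, IsInvariantOperatorRange L M → IsClosed (M : Set H),
      ∀ M, IsInvariantManifold L M → IsClosed (M : Set H)] := by
  tfae_have 1 → 2 := ascendingSequencesStabilize_of_isHyperatomic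
  tfae_have 2 → 1 := isHyperatomic_of_ascendingSequencesStabilize hL
  tfae_have 2 → 4 := fun h M hM => by
    obtain ⟨E, -, rfl⟩ := exists_mem_toSubmodule_eq_of_isInvariantManifold hL h hM
    exact E.isClosed
  tfae_have 4 → 3 := fun h M hM => h M hM.1
  tfae_have 3 → 2 := fun h => by_contra fun hnot => by
    obtain ⟨F, hFL, hF⟩ := exists_strictMono_of_not_ascendingSequencesStabilize hnot
    obtain ⟨M, hM, hMc⟩ := exists_isInvariantOperatorRange_not_isClosed hFL hF
    exact hMc (h M hM)
  tfae_finish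

theorem IsNest.tfae_ascendingSequencesStabilize (hN : IsNest L) (hL : IsCSL L) :
    List.TFAE [
      AscendingSequencesStabilize L,
      HasImmediatePredecessors L,
      ∀ M N, IsInvariantOperatorRange L M → IsInvariantOperatorRange L N → M ≤ N ∨ N ≤ M,
      ∀ M N, IsInvariantManifold L M → IsInvariantManifold L N → M ≤ N ∨ N ≤ M] := by
  tfae_have 1 → 2 := hasImmediatePredecessors_of_ascendingSequencesStabilize
  tfae_have 2 → 1 := hN.ascendingSequencesStabilize_of_hasImmediatePredecessors
  tfae_have 1 → 4 := fun h M N hM hN' => by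
    obtain ⟨E, hE, rfl⟩ := exists_mem_toSubmodule_eq_of_isInvariantManifold hL h hM
    obtain ⟨F, hF, rfl⟩ := exists_mem_toSubmodule_eq_of_isInvariantManifold hL h hN'
    exact hN E hE F hF
  tfae_have 4 → 3 := fun h M N hM hN' => h M N hM.1 hN'.1
  tfae_have 3 → 1 := fun h => by_contra fun hnot => by
    obtain ⟨F, hFL, hF⟩ := exists_strictMono_of_not_ascendingSequencesStabilize hnot
    obtain ⟨M, N, hM, hN', hMN, hNM⟩ := exists_isInvariantOperatorRange_incomparable hFL hF
    exact (h M N hM hN').elim hMN hNM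
  tfae_finish

end CommutativeSubspaceLattice

end SubspaceLattice

open SubspaceLattice in
theorem mainTheorem1_general {H : Type*} [NormedAddCommGroup H] [InnerProductSpace ℂ H]
    [CompleteSpace H] (L : CompleteSublattice (ClosedSubmodule ℂ H)) (hL : IsCSL L) :
    List.TFAE [
      IsHyperatomic L,
      AscendingSequencesStabilize L,
      ∀ M : Submodule ℂ H, IsInvariantOperatorRange L M → IsClosed (M : Set H),
      ∀ M : Submodule ℂ H, IsInvariantManifold L M → IsClosed (M : Set H)] ∧
    ((∀ M : Submodule ℂ H, IsInvariantOperatorRange L M → IsClosed (M : Set H)) →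
      ∀ M : Submodule ℂ H, IsInvariantOperatorRange L M → ∃ E ∈ L, E.toSubmodule = M) ∧
    ((∀ M : Submodule ℂ H, IsInvariantManifold L M → IsClosed (M : Set H)) →
      ∀ M : Submodule ℂ H, IsInvariantManifold L M → ∃ E ∈ L, E.toSubmodule = M) ∧
    (IsNest L →
      List.TFAE [
        IsHyperatomic L,
        AscendingSequencesStabilize L,
        ∀ M : Submodule ℂ H, IsInvariantOperatorRange L M → IsClosed (M : Set H),
        ∀ M : Submodule ℂ H, IsInvariantManifold L M → IsClosed (M : Set H),
        HasImmediatePredecessors L,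
        ∀ M N : Submodule ℂ H, IsInvariantOperatorRange L M →
          IsInvariantOperatorRange L N → M ≤ N ∨ N ≤ M,
        ∀ M N : Submodule ℂ H, IsInvariantManifold L M →
          IsInvariantManifold L N → M ≤ N ∨ N ≤ M]) := by
  have hCSL := tfae_ascendingSequencesStabilize hL
  refine ⟨hCSL, fun h M hM => ?_, fun h M hM => ?_, fun hN => ?_⟩
  · exact exists_mem_toSubmodule_eq_of_isInvariantManifold hL ((hCSL.out 2 1).1 h) hM.1
  · exact exists_mem_toSubmodule_eq_of_isInvariantManifold hL ((hCSL.out 3 1).1 h) hM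
  · have hnest := hN.tfae_ascendingSequencesStabilize hL
    tfae_have 1 ↔ 2 := hCSL.out 0 1
    tfae_have 2 ↔ 3 := hCSL.out 1 2
    tfae_have 2 ↔ 4 := hCSL.out 1 3
    tfae_have 2 ↔ 5 := hnest.out 0 1
    tfae_have 2 ↔ 6 := hnest.out 0 2
    tfae_have 2 ↔ 7 := hnest.out 0 3
    tfae_finish

theorem mainTheorem1 {H : Type*} [NormedAddCommGroup H] [InnerProductSpace ℂ H] [CompleteSpace H]
    [TopologicalSpace.SeparableSpace H] (L : CompleteSublattice (ClosedSubmodule ℂ H))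
    (hL : SubspaceLattice.IsCSL L) :
    List.TFAE [
      SubspaceLattice.IsHyperatomic L,
      SubspaceLattice.AscendingSequencesStabilize L,
      ∀ M : Submodule ℂ H, SubspaceLattice.IsInvariantOperatorRange L M → IsClosed (M : Set H),
      ∀ M : Submodule ℂ H, SubspaceLattice.IsInvariantManifold L M → IsClosed (M : Set H)] ∧
    ((∀ M : Submodule ℂ H, SubspaceLattice.IsInvariantOperatorRange L M → IsClosed (M : Set H)) →
      ∀ M : Submodule ℂ H, SubspaceLattice.IsInvariantOperatorRange L M →
        ∃ E ∈ L, E.toSubmodule = M) ∧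
    ((∀ M : Submodule ℂ H, SubspaceLattice.IsInvariantManifold L M → IsClosed (M : Set H)) →
      ∀ M : Submodule ℂ H, SubspaceLattice.IsInvariantManifold L M →
        ∃ E ∈ L, E.toSubmodule = M) ∧
    (SubspaceLattice.IsNest L →
      List.TFAE [
        SubspaceLattice.IsHyperatomic L,
        SubspaceLattice.AscendingSequencesStabilize L,
        ∀ M : Submodule ℂ H, SubspaceLattice.IsInvariantOperatorRange L M → IsClosed (M : Set H),
        ∀ M : Submodule ℂ H, SubspaceLattice.IsInvariantManifold L M → IsClosed (M : Set H),
        SubspaceLattice.HasImmediatePredecessors L,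
        ∀ M N : Submodule ℂ H, SubspaceLattice.IsInvariantOperatorRange L M →
          SubspaceLattice.IsInvariantOperatorRange L N → M ≤ N ∨ N ≤ M,
        ∀ M N : Submodule ℂ H, SubspaceLattice.IsInvariantManifold L M →
          SubspaceLattice.IsInvariantManifold L N → M ≤ N ∨ N ≤ M]) :=
  mainTheorem1_general L hL
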